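/- **Setting.** Let $\mathcal A,\mathcal X,\mathcal S_e,\mathcal S,\mathcal S_d,\mathcal Y,\mathcal Z,\hat{\mathcal S}$ be arbitrary measurable alphabets. For every $n$ let $d_n:\mathcal S^n\times\hat{\mathcal S}^n\to[0,\infty)$ be a measurable distortion function, let $P_{S^n_{e,i}S^n_iS^n_{d,i}|A^n}$ ($i=1,2$) be two state distributions given the action sequence, and let $P_{Y^n_jZ^n_j|X^nS^n}$ ($j=1,2$) be two channels. With weights $\alpha_i,\beta_j\ge 0$, $\alpha_1+\alpha_2=\beta_1+\beta_2=1$, the mixed states and the mixed channel are $$P_{S^n_eS^nS^n_d|A^n}=\sum_{i=1}^2\alpha_iP_{S^n_{e,i}S^n_iS^n_{d,i}|A^n},\qquad P_{Y^nZ^n|X^nS^n}=\sum_{j=1}^2\beta_jP_{Y^n_jZ^n_j|X^nS^n}.$$ A *process* is given by an auxiliary alphabet $\mathcal U$ and, for each $n$, laws $P_{A^n}$, $P_{U^n|A^nS_e^n}$, $P_{X^n|U^nS_e^n}$ and a measurable estimator $\hat S^n=g_n(X^n,A^n,S_e^n,Z^n)$; the joint law is $P_{A^n}P_{S^n_eS^nS^n_d|A^n}P_{U^n|A^nS^n_e}P_{X^n|U^nS^n_e}P_{Y^nZ^n|X^nS^n}$.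 Using the same inputs with the $i$-th state distribution and the $j$-th channel in place of the mixtures gives the component process $(\boldsymbol A,\boldsymbol U_i,\boldsymbol X_i,\boldsymbol S_{e,i},\boldsymbol S_i,\boldsymbol S_{d,i},\boldsymbol Y_{i,j},\boldsymbol Z_{i,j},\hat{\boldsymbol S}_{i,j})$. Write $$D(\boldsymbol S,\hat{\boldsymbol S})=\limsup_{n\to\infty}\tfrac1n\mathbb E[d_n(S^n,\hat S^n)],$$ and let $$\underline I(\boldsymbol A,\boldsymbol U;\boldsymbol S_d,\boldsymbol Y)=\text{p-}\liminf_{n\to\infty}\tfrac1n\log\frac{P_{Y^nS_d^n|A^nU^n}}{P_{Y^nS_d^n}},\qquad \overline I(\boldsymbol U;\boldsymbol S_e|\boldsymbol A)=\text{p-}\limsup_{n\to\infty}\tfrac1n\log\frac{P_{U^n|A^nS_e^n}}{P_{U^n|A^n}}$$ be the spectral inf-mutual information rate and the spectral sup-conditional mutual information rate. For real $C$ let $$D_a(C)=\sup\{D(\boldsymbol S,\hat{\boldsymbol S}) : \underline I(\boldsymbol A,\boldsymbol U;\boldsymbol Y,\boldsymbol S_d)-\overline I(\boldsymbol U;\boldsymbol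 S_e|\boldsymbol A)\le C\}$$ be the distortion-capacity function of the mixed model (supremum over all processes). **Theorem 4.** For every real $C$, $$D_a(C)\le B(C):=\sup\ \sum_{i=1}^2\sum_{j=1}^2\alpha_i\beta_jD(\boldsymbol S_i,\hat{\boldsymbol S}_{i,j}),$$ where the supremum is over all processes with $$\min_{i,j\in\{1,2\}}\underline I(\boldsymbol A,\boldsymbol U_i;\boldsymbol S_{d,i},\boldsymbol Y_{i,j})-\max_{i\in\{1,2\}}\overline I(\boldsymbol U_i;\boldsymbol S_{e,i}|\boldsymbol A)\le C.$$ The same bound holds for the distortion-capacity function defined through codes: for every $C\ge0$ such that $(C,D)$ is average-achievable on the mixed model for some finite $D$, $\inf\{D:(C,D)\text{ is average-achievable}\}\le B(C)$. Here $(C,D)$ is average-achievable if for every $\epsilon>0$ there are codes of length $n=1,2,\dots$ (action encoder $a^n(m)$, message encoder $x^n(m,s_e^n)$, decoder $\hat m(y^n,s_d^n)$, and estimator $\hat s^n=g_n(x^n,a^n,s_e^n,z^n)$, with a uniformly distributed message $m\in\mathcal M_n$) with $\liminf\frac1n\log|\mathcal M_n|\ge C$, limsup of the average decoding error probability at most $\epsilon$,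 and $\limsup\frac1n\mathbb E[d_n(S^n,\hat S^n)]\le D$. -/

import Mathlib

open MeasureTheory ProbabilityTheory Filter
open scoped NNReal ENNReal Topology

universe u

noncomputable section

namespace ISAC

/-! ### Information-spectrum quantities -/

section Spectrum

/-- `p-limsup Z_n = inf {a | Pr{Z_n > a} → 0}`, where `Z_n` is a random variable on its own
probability space `(Ω n, μ n)`; values in the extended reals. -/
def pLimsup {Ω : ℕ → Type u} [∀ n, MeasurableSpace (Ω n)] (μ : ∀ n, Measure (Ω n))
    (Z : ∀ n, Ω n → EReal) : EReal :=
  sInf {a : EReal | Tendsto (fun n => μ n {ω | a < Z n ω}) atTop (𝓝 0)}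

/-- `p-liminf Z_n = sup {b | Pr{Z_n < b} → 0}`. -/
def pLiminf {Ω : ℕ → Type u} [∀ n, MeasurableSpace (Ω n)] (μ : ∀ n, Measure (Ω n))
    (Z : ∀ n, Ω n → EReal) : EReal :=
  sSup {b : EReal | Tendsto (fun n => μ n {ω | Z n ω < b}) atTop (𝓝 0)}

/-- Likelihood ratio `dμ/dν` of two finite measures with values in `[0, ∞]`. It is the
Radon-Nikodym derivative `ν`-almost everywhere, and equals `∞` on the part of `μ` which is
singular to `ν` (so nothing is lost when `μ` is not absolutely continuous). -/
def likelihoodRatio {Ω : Type u} [MeasurableSpace Ω] (μ ν : Measure Ω) (ω : Ω) : ℝ≥0∞ :=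
  μ.rnDeriv (μ + ν) ω / ν.rnDeriv (μ + ν) ω

/-- Information density `log (dP_{XY} / d(P_X × P_Y)) = log (P_{Y|X}(y|x) / P_Y(y))` of a joint
law on `α × β`. -/
def infoDensity {α β : Type u} [MeasurableSpace α] [MeasurableSpace β]
    (P : Measure (α × β)) (q : α × β) : EReal :=
  ENNReal.log (likelihoodRatio P (P.fst.prod P.snd) q)

/-- Conditional information density
`log (P_{XY|A} / (P_{X|A} P_{Y|A})) = log (P_{Y|AX}(y|a,x) / P_{Y|A}(y|a))`,
for `A` with law `μ` and `(X, Y)` with conditional law `κ` given `A`. -/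
def condInfoDensity {α β γ : Type u} [MeasurableSpace α] [MeasurableSpace β] [MeasurableSpace γ]
    (μ : Measure α) (κ : Kernel α (β × γ)) (q : α × β × γ) : EReal :=
  ENNReal.log (likelihoodRatio (μ ⊗ₘ κ) (μ ⊗ₘ (κ.fst ×ₖ κ.snd)) q)

/-- Spectral inf-mutual information rate of the general pair with joint laws `P n`. -/
def infMutualInfoRate {α β : ℕ → Type u} [∀ n, MeasurableSpace (α n)]
    [∀ n, MeasurableSpace (β n)] (P : ∀ n, Measure (α n × β n)) : EReal :=
  pLiminf P fun n q => ((1 / n : ℝ) : EReal) * infoDensity (P n) q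

/-- Spectral sup-conditional mutual information rate of `(X, Y)` given `A`, where `A^n` has law
`μ n` and `(X^n, Y^n)` has conditional law `κ n` given `A^n`. -/
def supCondMutualInfoRate {α β γ : ℕ → Type u} [∀ n, MeasurableSpace (α n)]
    [∀ n, MeasurableSpace (β n)] [∀ n, MeasurableSpace (γ n)]
    (μ : ∀ n, Measure (α n)) (κ : ∀ n, Kernel (α n) (β n × γ n)) : EReal :=
  pLimsup (fun n => μ n ⊗ₘ κ n) fun n q =>
    ((1 / n : ℝ) : EReal) * condInfoDensity (μ n) (κ n) q

end Spectrum

/-! ### Mixtures of two kernels -/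

/-- The convex combination `w 0 • κ 0 + w 1 • κ 1` of two kernels. -/
def mix {α β : Type u} [MeasurableSpace α] [MeasurableSpace β] (w : Fin 2 → ℝ≥0)
    (κ : Fin 2 → Kernel α β) : Kernel α β where
  toFun a := ∑ i, (w i : ℝ≥0∞) • κ i a
  measurable' := by
    refine Measure.measurable_of_measurable_coe _ fun s hs => ?_
    simp only [Measure.coe_finsetSum, Finset.sum_apply, Measure.smul_apply, smul_eq_mul]
    exact Finset.measurable_sum _ fun i _ => ((κ i).measurable_coe hs).const_mul _

theorem isMarkovKernel_mix {α β : Type u} [MeasurableSpace α] [MeasurableSpace β]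
    {w : Fin 2 → ℝ≥0} (hw : w 0 + w 1 = 1) (κ : Fin 2 → Kernel α β)
    [∀ i, IsMarkovKernel (κ i)] : IsMarkovKernel (mix w κ) := by
  refine ⟨fun a => ⟨?_⟩⟩
  change (∑ i, (w i : ℝ≥0∞) • κ i a) Set.univ = 1
  rw [Fin.sum_univ_two, Measure.add_apply, Measure.smul_apply, Measure.smul_apply, measure_univ,
    measure_univ, smul_eq_mul, smul_eq_mul, mul_one, mul_one]
  exact_mod_cast hw

/-! ### The action-dependent model -/

/-- Sequences of length `n` over an alphabet. -/
abbrev Seq (n : ℕ) (𝒳 : Type u) : Type u := Fin n → 𝒳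

/-- State distribution: for every `n`, the conditional law `P_{S_e^n S^n S_d^n | A^n}`. -/
abbrev StateLaw (𝒜 𝒮e 𝒮 𝒮d : Type u) [MeasurableSpace 𝒜] [MeasurableSpace 𝒮e]
    [MeasurableSpace 𝒮] [MeasurableSpace 𝒮d] : Type u :=
  ∀ n : ℕ, Kernel (Seq n 𝒜) (Seq n 𝒮e × Seq n 𝒮 × Seq n 𝒮d)

/-- General channel: for every `n`, the conditional law `P_{Y^n Z^n | X^n S^n}`. -/
abbrev Channel (𝒳 𝒮 𝒴 𝒵 : Type u) [MeasurableSpace 𝒳] [MeasurableSpace 𝒮]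
    [MeasurableSpace 𝒴] [MeasurableSpace 𝒵] : Type u :=
  ∀ n : ℕ, Kernel (Seq n 𝒳 × Seq n 𝒮) (Seq n 𝒴 × Seq n 𝒵)

/-- What is chosen freely in a process `(A, U, X, S_e, S, S_d, Y, Z, Ŝ)`: the auxiliary alphabet
`𝒰`, the laws `P_{A^n}`, `P_{U^n | A^n S_e^n}`, `P_{X^n | U^n S_e^n}` and the estimators `g_n`,
with `Ŝ^n = g_n (X^n, A^n, S_e^n, Z^n)`. -/
structure InputProcess (𝒜 𝒳 𝒮e 𝒵 𝒮hat : Type u) [MeasurableSpace 𝒜] [MeasurableSpace 𝒳]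
    [MeasurableSpace 𝒮e] [MeasurableSpace 𝒵] [MeasurableSpace 𝒮hat] where
  𝒰 : Type u
  [measurableSpaceU : MeasurableSpace 𝒰]
  lawA : ∀ n : ℕ, Measure (Seq n 𝒜)
  lawU : ∀ n : ℕ, Kernel (Seq n 𝒜 × Seq n 𝒮e) (Seq n 𝒰)
  lawX : ∀ n : ℕ, Kernel (Seq n 𝒰 × Seq n 𝒮e) (Seq n 𝒳)
  g : ∀ n : ℕ, Seq n 𝒳 × Seq n 𝒜 × Seq n 𝒮e × Seq n 𝒵 → Seq n 𝒮hat
  [isProbabilityMeasure_lawA : ∀ n, IsProbabilityMeasure (lawA n)]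
  [isMarkovKernel_lawU : ∀ n, IsMarkovKernel (lawU n)]
  [isMarkovKernel_lawX : ∀ n, IsMarkovKernel (lawX n)]
  measurable_g : ∀ n, Measurable (g n)

attribute [instance] InputProcess.measurableSpaceU InputProcess.isProbabilityMeasure_lawA
  InputProcess.isMarkovKernel_lawU InputProcess.isMarkovKernel_lawX

variable {𝒜 𝒳 𝒮e 𝒮 𝒮d 𝒴 𝒵 𝒮hat : Type u}
  [MeasurableSpace 𝒜] [MeasurableSpace 𝒳] [MeasurableSpace 𝒮e] [MeasurableSpace 𝒮]
  [MeasurableSpace 𝒮d] [MeasurableSpace 𝒴] [MeasurableSpace 𝒵] [MeasurableSpace 𝒮hat]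

namespace InputProcess

/-- Sample space of `(A^n, S_e^n, S^n, S_d^n, U^n, X^n, Y^n, Z^n)`, nested in the order in which
the variables are generated. -/
abbrev Outcome (p : InputProcess 𝒜 𝒳 𝒮e 𝒵 𝒮hat) (𝒮 𝒮d 𝒴 : Type u) (n : ℕ) : Type u :=
  Seq n 𝒜 × (((Seq n 𝒮e × Seq n 𝒮 × Seq n 𝒮d) × Seq n p.𝒰) × Seq n 𝒳) × (Seq n 𝒴 × Seq n 𝒵)

/-- The joint law
`P_{A^n} P_{S_e^n S^n S_d^n|A^n} P_{U^n|A^n S_e^n} P_{X^n|U^n S_e^n} P_{Y^n Z^n|X^n S^n}`. -/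
def jointLaw (p : InputProcess 𝒜 𝒳 𝒮e 𝒵 𝒮hat) (Q : StateLaw 𝒜 𝒮e 𝒮 𝒮d)
    (W : Channel 𝒳 𝒮 𝒴 𝒵) (n : ℕ) : Measure (p.Outcome 𝒮 𝒮d 𝒴 n) :=
  p.lawA n ⊗ₘ
    (((Q n
      ⊗ₖ (p.lawU n).comap
        (fun q : Seq n 𝒜 × (Seq n 𝒮e × Seq n 𝒮 × Seq n 𝒮d) => (q.1, q.2.1)) (by fun_prop))
      ⊗ₖ (p.lawX n).comap
        (fun q : Seq n 𝒜 × ((Seq n 𝒮e × Seq n 𝒮 × Seq n 𝒮d) × Seq n p.𝒰) => (q.2.2, q.2.1.1))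
        (by fun_prop))
      ⊗ₖ (W n).comap
        (fun q : Seq n 𝒜 × (((Seq n 𝒮e × Seq n 𝒮 × Seq n 𝒮d) × Seq n p.𝒰) × Seq n 𝒳) =>
          (q.2.2, q.2.1.1.2.1))
        (by fun_prop))

/-- The joint law of `((A^n, U^n), (S_d^n, Y^n))`. -/
def lawAUSdY (p : InputProcess 𝒜 𝒳 𝒮e 𝒵 𝒮hat) (Q : StateLaw 𝒜 𝒮e 𝒮 𝒮d)
    (W : Channel 𝒳 𝒮 𝒴 𝒵) (n : ℕ) :
    Measure ((Seq n 𝒜 × Seq n p.𝒰) × (Seq n 𝒮d × Seq n 𝒴)) :=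
  (p.jointLaw Q W n).map fun ω => ((ω.1, ω.2.1.1.2), (ω.2.1.1.1.2.2, ω.2.2.1))

/-- The conditional law of `(S_e^n, U^n)` given `A^n`, namely `P_{S_e^n|A^n} P_{U^n|A^n S_e^n}`. -/
def condLawSeU (p : InputProcess 𝒜 𝒳 𝒮e 𝒵 𝒮hat) (Q : StateLaw 𝒜 𝒮e 𝒮 𝒮d) (n : ℕ) :
    Kernel (Seq n 𝒜) (Seq n 𝒮e × Seq n p.𝒰) :=
  (Q n).fst ⊗ₖ p.lawU n

/-- The spectral inf-mutual information rate `I̲(A, U; S_d, Y)`. -/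
def infRate (p : InputProcess 𝒜 𝒳 𝒮e 𝒵 𝒮hat) (Q : StateLaw 𝒜 𝒮e 𝒮 𝒮d)
    (W : Channel 𝒳 𝒮 𝒴 𝒵) : EReal :=
  infMutualInfoRate (p.lawAUSdY Q W)

/-- The spectral sup-conditional mutual information rate `Ī(U; S_e | A)`. -/
def supRate (p : InputProcess 𝒜 𝒳 𝒮e 𝒵 𝒮hat) (Q : StateLaw 𝒜 𝒮e 𝒮 𝒮d) : EReal :=
  supCondMutualInfoRate p.lawA (p.condLawSeU Q)

/-- The average distortion `D(S, Ŝ) = limsup (1/n) E[d_n(S^n, g_n(X^n, A^n, S_e^n, Z^n))]`. -/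
def avgDistortion (p : InputProcess 𝒜 𝒳 𝒮e 𝒵 𝒮hat) (d : ∀ n, Seq n 𝒮 × Seq n 𝒮hat → ℝ≥0)
    (Q : StateLaw 𝒜 𝒮e 𝒮 𝒮d) (W : Channel 𝒳 𝒮 𝒴 𝒵) : ℝ≥0∞ :=
  limsup (fun n : ℕ =>
    (∫⁻ ω, (d n (ω.2.1.1.1.2.1, p.g n (ω.2.1.2, ω.1, ω.2.1.1.1.1, ω.2.2.2)) : ℝ≥0∞)
      ∂(p.jointLaw Q W n)) / n) atTop

end InputProcess

/-- The distortion-capacity function in its information-spectrum form: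
`D_a(C) = sup D(S, Ŝ)` over processes with `I̲(A, U; Y, S_d) - Ī(U; S_e | A) ≤ C`. -/
def distortionCapacity (d : ∀ n, Seq n 𝒮 × Seq n 𝒮hat → ℝ≥0)
    (Q : StateLaw 𝒜 𝒮e 𝒮 𝒮d) (W : Channel 𝒳 𝒮 𝒴 𝒵) (C : ℝ) : ℝ≥0∞ :=
  ⨆ (p : InputProcess 𝒜 𝒳 𝒮e 𝒵 𝒮hat) (_ : p.infRate Q W - p.supRate Q ≤ (C : EReal)),
    p.avgDistortion d Q W

/-- The bound for mixed states and channels: the supremum of `∑ α_i β_j D(S_i, Ŝ_{i,j})` over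
processes with `min_{i,j} I̲(A, U_i; S_{d,i}, Y_{i,j}) - max_i Ī(U_i; S_{e,i} | A) ≤ C`. -/
def mixedDistortionBound (d : ∀ n, Seq n 𝒮 × Seq n 𝒮hat → ℝ≥0) (α β : Fin 2 → ℝ≥0)
    (Q : Fin 2 → StateLaw 𝒜 𝒮e 𝒮 𝒮d) (W : Fin 2 → Channel 𝒳 𝒮 𝒴 𝒵) (C : ℝ) : ℝ≥0∞ :=
  ⨆ (p : InputProcess 𝒜 𝒳 𝒮e 𝒵 𝒮hat)
    (_ : (⨅ i, ⨅ j, p.infRate (Q i) (W j)) - (⨆ i, p.supRate (Q i)) ≤ (C : EReal)),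
    ∑ i, ∑ j, (α i : ℝ≥0∞) * (β j : ℝ≥0∞) * p.avgDistortion d (Q i) (W j)

/-! ### Codes and the operational distortion-capacity function -/

/-- A code of block length `n` with message set `Fin M`. -/
structure Code (𝒜 𝒳 𝒮e 𝒮d 𝒴 𝒵 𝒮hat : Type u) [MeasurableSpace 𝒜] [MeasurableSpace 𝒳]
    [MeasurableSpace 𝒮e] [MeasurableSpace 𝒮d] [MeasurableSpace 𝒴] [MeasurableSpace 𝒵]
    [MeasurableSpace 𝒮hat] (n : ℕ) where
  M : ℕ
  M_pos : 0 < M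
  fA : Fin M → Seq n 𝒜
  f : Fin M → Seq n 𝒮e → Seq n 𝒳
  h : Seq n 𝒴 × Seq n 𝒮d → Fin M
  g : Seq n 𝒳 × Seq n 𝒜 × Seq n 𝒮e × Seq n 𝒵 → Seq n 𝒮hat
  measurable_f : ∀ m, Measurable (f m)
  measurable_h : Measurable h
  measurable_g : Measurable g

namespace Code

variable {n : ℕ}

/-- Average decoding error probability, for a uniformly distributed message. -/
def errorProb (c : Code 𝒜 𝒳 𝒮e 𝒮d 𝒴 𝒵 𝒮hat n) (Q : StateLaw 𝒜 𝒮e 𝒮 𝒮d)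
    (W : Channel 𝒳 𝒮 𝒴 𝒵) : ℝ≥0∞ :=
  (∑ m, ∫⁻ s, W n (c.f m s.1, s.2.1) {y | c.h (y.1, s.2.2) ≠ m} ∂(Q n (c.fA m))) / c.M

/-- Expected (unnormalized) distortion `E[d_n(S^n, g_n(f(M, S_e^n), f_A(M), S_e^n, Z^n))]`. -/
def expectedDistortion (c : Code 𝒜 𝒳 𝒮e 𝒮d 𝒴 𝒵 𝒮hat n)
    (d : ∀ n, Seq n 𝒮 × Seq n 𝒮hat → ℝ≥0) (Q : StateLaw 𝒜 𝒮e 𝒮 𝒮d)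
    (W : Channel 𝒳 𝒮 𝒴 𝒵) : ℝ≥0∞ :=
  (∑ m, ∫⁻ s, ∫⁻ y, (d n (s.2.1, c.g (c.f m s.1, c.fA m, s.1, y.2)) : ℝ≥0∞)
    ∂(W n (c.f m s.1, s.2.1)) ∂(Q n (c.fA m))) / c.M

end Code

/-- The pair `(R, D)` is average-achievable. -/
def AverageAchievable (d : ∀ n, Seq n 𝒮 × Seq n 𝒮hat → ℝ≥0) (Q : StateLaw 𝒜 𝒮e 𝒮 𝒮d)
    (W : Channel 𝒳 𝒮 𝒴 𝒵) (R : ℝ) (D : ℝ≥0) : Prop :=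
  ∀ ε : ℝ, 0 < ε → ∃ c : ∀ n, Code 𝒜 𝒳 𝒮e 𝒮d 𝒴 𝒵 𝒮hat n,
    (R : EReal) ≤ liminf (fun n : ℕ => ((Real.log (c n).M / n : ℝ) : EReal)) atTop ∧
    limsup (fun n : ℕ => (c n).errorProb Q W) atTop ≤ ENNReal.ofReal ε ∧
    limsup (fun n : ℕ => (c n).expectedDistortion d Q W / n) atTop ≤ (D : ℝ≥0∞)

/-- The operational distortion-capacity function: the smallest average distortion (an infimum)
that is achievable at rate `C`; it is `∞` if there is none. -/
def operationalDistortion (d : ∀ n, Seq n 𝒮 × Seq n 𝒮hat → ℝ≥0) (Q : StateLaw 𝒜 𝒮e 𝒮 𝒮d)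
    (W : Channel 𝒳 𝒮 𝒴 𝒵) (C : ℝ) : ℝ≥0∞ :=
  ⨅ (D : ℝ≥0) (_ : AverageAchievable d Q W C D), (D : ℝ≥0∞)

end ISAC

end

/-! Fix one process and compare its mixed law with its four component laws. The mixed joint law is
the sum of the component laws with weights `α i * β j`, so each component is dominated by the
mixture up to a constant factor, which vanishes in the exponent after dividing by `n`.

For the inf-rate, let `w • P' ≤ P`. The density of `P` against the product of its marginals can drop
below that of `P'` through the factor `w` or through large marginals of `P`. By Markov's inequality
each marginal ratio exceeds `K` with `P'`-probability at most `1 / K`. With `K` exponential at a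
small rate, the mixed inf-rate is at least the smallest component rate (`measure_infoRatio_lt_le`,
`iInf_infMutualInfoRate_le`).

For the sup-rate, `U` is drawn from `(A, S_e)` by the same kernel in all components. Only the
denominator `P_{U|A}` changes, and it drops at most by the factor `w` from mixture to component
(`measure_lt_condInfoRatio_le`, `supCondMutualInfoRate_le_iSup`). Hence every process feasible for
the mixed model is feasible for the bound, and subadditivity of limsup bounds its distortion.

The operational form needs no coding theorem. Always sending the worst message of each code gives a
process with deterministic action and trivial `U`, whose rate expression is at most `0 ≤ C`. So
every code sequence has distortion at most the bound, and codes achieving some distortion also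
achieve the bound. -/

namespace ISAC

/-! ### Likelihood ratios and exponential thresholds -/

section LikelihoodRatio

variable {Ω : Type u} [MeasurableSpace Ω]

theorem measurable_likelihoodRatio (μ ν : Measure Ω) : Measurable (likelihoodRatio μ ν) :=
  (Measure.measurable_rnDeriv _ _).div (Measure.measurable_rnDeriv _ _)

theorem setLIntegral_rnDeriv_add_left (μ ν : Measure Ω) [IsFiniteMeasure μ] [IsFiniteMeasure ν]
    (B : Set Ω) : ∫⁻ ω in B, μ.rnDeriv (μ + ν) ω ∂(μ + ν) = μ B :=
  Measure.setLIntegral_rnDeriv (Measure.le_add_right le_rfl).absolutelyContinuous _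

theorem setLIntegral_rnDeriv_add_right (μ ν : Measure Ω) [IsFiniteMeasure μ] [IsFiniteMeasure ν]
    (B : Set Ω) : ∫⁻ ω in B, ν.rnDeriv (μ + ν) ω ∂(μ + ν) = ν B :=
  Measure.setLIntegral_rnDeriv (Measure.le_add_left le_rfl).absolutelyContinuous _

/-- Where the likelihood ratio is at most `c`, the first measure is at most `c` times the second. -/
theorem measure_le_of_likelihoodRatio_le (μ ν : Measure Ω) [IsFiniteMeasure μ] [IsFiniteMeasure ν]
    {c : ℝ≥0∞} (hc : c ≠ ∞) {B : Set Ω} (hB : MeasurableSet B)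
    (h : ∀ ω ∈ B, likelihoodRatio μ ν ω ≤ c) : μ B ≤ c * ν B := by
  rw [← setLIntegral_rnDeriv_add_left μ ν B, ← setLIntegral_rnDeriv_add_right μ ν B,
    ← lintegral_const_mul _ (Measure.measurable_rnDeriv _ _)]
  refine lintegral_mono_ae ?_
  -- An infinite denominator would make the quotient zero and lose the bound; a zero denominator is
  -- harmless because `c` is finite.
  have h1 : ∀ᵐ ω ∂(μ + ν), ν.rnDeriv (μ + ν) ω < ∞ := Measure.rnDeriv_lt_top _ _
  filter_upwards [ae_restrict_mem hB, ae_restrict_of_ae h1] with ω hω hν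
  exact (ENNReal.div_le_iff_le_mul (.inr hc) (.inl hν.ne)).1 (h ω hω)

/-- Where the likelihood ratio is at least `c`, the first measure is at least `c` times the
second. -/
theorem le_measure_of_le_likelihoodRatio (μ ν : Measure Ω) [IsFiniteMeasure μ] [IsFiniteMeasure ν]
    {c : ℝ≥0∞} {B : Set Ω} (hB : MeasurableSet B)
    (h : ∀ ω ∈ B, c ≤ likelihoodRatio μ ν ω) : c * ν B ≤ μ B := by
  rw [← setLIntegral_rnDeriv_add_left μ ν B, ← setLIntegral_rnDeriv_add_right μ ν B,
    ← lintegral_const_mul _ (Measure.measurable_rnDeriv _ _)]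
  refine lintegral_mono_ae ?_
  filter_upwards [ae_restrict_mem hB] with ω hω
  exact ENNReal.mul_le_of_le_div (h ω hω)

theorem measure_eq_zero_of_mul_le_mul {μ : Measure Ω} [IsFiniteMeasure μ] {a b : ℝ≥0∞} (hab : a < b)
    {B : Set Ω} (h : b * μ B ≤ a * μ B) : μ B = 0 := by
  by_contra h0
  exact absurd ((ENNReal.mul_le_mul_iff_left h0 (measure_ne_top μ B)).1 h) hab.not_ge

/-- The ratio of `μ` to itself is `1` almost everywhere: on a set where it is at most `c`, `μ B ≤ c
* μ B` forces `μ B = 0`. -/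
theorem measure_likelihoodRatio_self_le (μ : Measure Ω) [IsFiniteMeasure μ] {c : ℝ≥0∞}
    (hc : c < 1) : μ {ω | likelihoodRatio μ μ ω ≤ c} = 0 :=
  measure_eq_zero_of_mul_le_mul hc <| by
    rw [one_mul]
    exact measure_le_of_likelihoodRatio_le μ μ hc.ne_top
      (measurable_likelihoodRatio μ μ measurableSet_Iic) fun ω hω => hω

theorem measure_le_likelihoodRatio_self (μ : Measure Ω) [IsFiniteMeasure μ] {c : ℝ≥0∞}
    (hc : 1 < c) : μ {ω | c ≤ likelihoodRatio μ μ ω} = 0 :=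
  measure_eq_zero_of_mul_le_mul hc <| by
    rw [one_mul]
    exact le_measure_of_le_likelihoodRatio μ μ
      (measurable_likelihoodRatio μ μ measurableSet_Ici) fun ω hω => hω

/-- Markov's inequality for likelihood ratios. -/
theorem mul_measure_lt_likelihoodRatio_le (μ ν : Measure Ω) [IsProbabilityMeasure μ]
    [IsFiniteMeasure ν] (K : ℝ≥0∞) : ν {ω | K < likelihoodRatio μ ν ω} ≤ K⁻¹ := by
  rw [← one_div]
  refine ENNReal.le_div_iff_mul_le (.inr one_ne_zero) (.inr ENNReal.one_ne_top) |>.2 ?_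
  rw [mul_comm]
  exact (le_measure_of_le_likelihoodRatio μ ν (measurable_likelihoodRatio μ ν measurableSet_Ioi)
    fun ω hω => le_of_lt hω).trans prob_le_one

/-- Turns a threshold on the normalised density into one on the ratio, so the comparisons can be
made without logarithms. -/
theorem scaled_log_lt_iff {n : ℕ} (hn : n ≠ 0) (r : ℝ≥0∞) (b : ℝ) :
    ((1 / n : ℝ) : EReal) * ENNReal.log r < b ↔ r < ENNReal.ofReal (Real.exp (n * b)) := by
  have hn0 : (0 : ℝ) < n := by positivity
  have h1 : ENNReal.log (ENNReal.ofReal (Real.exp (n * b))) = ((n * b : ℝ) : EReal) := by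
    rw [ENNReal.log_ofReal_of_pos (Real.exp_pos _), Real.log_exp]
  rw [← ENNReal.log_lt_log_iff, h1, one_div, EReal.coe_inv, mul_comm, ← div_eq_mul_inv,
    EReal.div_lt_iff (by exact_mod_cast hn0) (EReal.coe_ne_top _), mul_comm (n : ℝ), EReal.coe_mul]

theorem lt_scaled_log_iff {n : ℕ} (hn : n ≠ 0) (r : ℝ≥0∞) (b : ℝ) :
    (b : EReal) < ((1 / n : ℝ) : EReal) * ENNReal.log r ↔
      ENNReal.ofReal (Real.exp (n * b)) < r := by
  have hn0 : (0 : ℝ) < n := by positivity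
  have h1 : ENNReal.log (ENNReal.ofReal (Real.exp (n * b))) = ((n * b : ℝ) : EReal) := by
    rw [ENNReal.log_ofReal_of_pos (Real.exp_pos _), Real.log_exp]
  rw [← ENNReal.log_lt_log_iff, h1, one_div, EReal.coe_inv, mul_comm, ← div_eq_mul_inv,
    EReal.lt_div_iff (by exact_mod_cast hn0) (EReal.coe_ne_top _), mul_comm (n : ℝ), EReal.coe_mul]

end LikelihoodRatio

/-! ### Densities of a mixture against those of a component -/

section Comparison

variable {α β γ : Type u} [MeasurableSpace α] [MeasurableSpace β] [MeasurableSpace γ]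

/-- If `P'` is dominated by `w⁻¹ P`, then, up to the cost `2 / K` of controlling the two marginals,
the information density of `P` is not much smaller than that of `P'` with high `P'`-probability. -/
theorem measure_infoRatio_lt_le (P P' : Measure (α × β)) [IsProbabilityMeasure P]
    [IsProbabilityMeasure P'] {w c c' K : ℝ≥0∞} (hw : w ≠ 0) (hPP' : w • P' ≤ P)
    (hc : c ≠ ∞) (hK : K ≠ ∞) (hlt : c * (K * K) < w * c') :
    P' {q | likelihoodRatio P (P.fst.prod P.snd) q < c} ≤
      P' {q | likelihoodRatio P' (P'.fst.prod P'.snd) q < c'} + (K⁻¹ + K⁻¹) := by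
  set T := {q | likelihoodRatio P (P.fst.prod P.snd) q < c}
  set N := {q | likelihoodRatio P' (P'.fst.prod P'.snd) q < c'}
  set E₁ := {a | likelihoodRatio P.fst P'.fst a ≤ K}
  set E₂ := {b | likelihoodRatio P.snd P'.snd b ≤ K}
  have hT : MeasurableSet T := measurable_likelihoodRatio _ _ measurableSet_Iio
  have hN : MeasurableSet N := measurable_likelihoodRatio _ _ measurableSet_Iio
  have hE₁ : MeasurableSet E₁ := measurable_likelihoodRatio _ _ measurableSet_Iic
  have hE₂ : MeasurableSet E₂ := measurable_likelihoodRatio _ _ measurableSet_Iic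
  have hbad₁ : P' (Prod.fst ⁻¹' E₁ᶜ) ≤ K⁻¹ := by
    rw [← Measure.fst_apply hE₁.compl]
    refine (measure_mono fun a (ha : ¬ _ ≤ K) => ?_).trans (mul_measure_lt_likelihoodRatio_le P.fst P'.fst K)
    exact not_le.1 ha
  have hbad₂ : P' (Prod.snd ⁻¹' E₂ᶜ) ≤ K⁻¹ := by
    rw [← Measure.snd_apply hE₂.compl]
    refine (measure_mono fun a (ha : ¬ _ ≤ K) => ?_).trans (mul_measure_lt_likelihoodRatio_le P.snd P'.snd K)
    exact not_le.1 ha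
  -- What remains of `T` outside the bad events. Here the density of `P` is too small and that of
  -- `P'` large while both marginals are controlled; these are incompatible, so `B` is `P'`-null.
  set B := (T ∩ Nᶜ) ∩ (E₁ ×ˢ E₂)
  have hB : MeasurableSet B := (hT.inter hN.compl).inter (hE₁.prod hE₂)
  have hmarg₁ : P.fst.restrict E₁ ≤ K • P'.fst := Measure.le_iff.2 fun s hs => by
    rw [Measure.restrict_apply hs, Measure.smul_apply, smul_eq_mul]
    exact (measure_le_of_likelihoodRatio_le _ _ hK (hs.inter hE₁) fun ω hω => hω.2).trans
      (mul_le_mul_right (measure_mono Set.inter_subset_left) _)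
  have hmarg₂ : P.snd.restrict E₂ ≤ K • P'.snd := Measure.le_iff.2 fun s hs => by
    rw [Measure.restrict_apply hs, Measure.smul_apply, smul_eq_mul]
    exact (measure_le_of_likelihoodRatio_le _ _ hK (hs.inter hE₂) fun ω hω => hω.2).trans
      (mul_le_mul_right (measure_mono Set.inter_subset_left) _)
  have hprod : (P.fst.prod P.snd) B ≤ K * K * (P'.fst.prod P'.snd) B := by
    calc (P.fst.prod P.snd) B
        = ((P.fst.prod P.snd).restrict (E₁ ×ˢ E₂)) B := by
          rw [Measure.restrict_apply hB, Set.inter_eq_left.2 Set.inter_subset_right]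
      _ = ((P.fst.restrict E₁).prod (P.snd.restrict E₂)) B := by rw [Measure.prod_restrict]
      _ ≤ ((K • P'.fst).prod (K • P'.snd)) B := Measure.prod_mono hmarg₁ hmarg₂ B
      _ = K * K * (P'.fst.prod P'.snd) B := by
          rw [Measure.prod_apply hB, Measure.prod_apply hB, lintegral_smul_measure]
          simp only [Measure.smul_apply, smul_eq_mul]
          rw [lintegral_const_mul _ (measurable_measure_prodMk_left hB), mul_assoc]
  have h1 : c' * (P'.fst.prod P'.snd) B ≤ P' B :=
    le_measure_of_le_likelihoodRatio _ _ hB fun q hq => not_lt.1 hq.1.2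
  have h2 : P B ≤ c * (P.fst.prod P.snd) B :=
    measure_le_of_likelihoodRatio_le _ _ hc hB fun q hq => le_of_lt hq.1.1
  have h3 : w * P' B ≤ c * (K * K) * (P'.fst.prod P'.snd) B := by
    calc w * P' B = (w • P') B := rfl
      _ ≤ P B := hPP' B
      _ ≤ c * (P.fst.prod P.snd) B := h2
      _ ≤ c * (K * K * (P'.fst.prod P'.snd) B) := mul_le_mul_right hprod _
      _ = _ := by simp only [mul_assoc]
  -- Chaining gives `w * c' * x ≤ c * K² * x` for `x` the product measure of `B`, against `hlt`.
  have h4 : (P'.fst.prod P'.snd) B = 0 := by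
    refine measure_eq_zero_of_mul_le_mul hlt (le_trans ?_ h3)
    rw [mul_assoc]
    exact mul_le_mul_right h1 _
  have h5 : P' B = 0 := by
    rw [h4, mul_zero, nonpos_iff_eq_zero] at h3
    exact (mul_eq_zero.1 h3).resolve_left hw
  have hcover : T ⊆ N ∪ (Prod.fst ⁻¹' E₁ᶜ ∪ Prod.snd ⁻¹' E₂ᶜ) ∪ B := by
    intro q hq
    by_cases hqN : q ∈ N
    · exact .inl (.inl hqN)
    by_cases hq1 : q.1 ∈ E₁
    · by_cases hq2 : q.2 ∈ E₂
      · exact .inr ⟨⟨hq, hqN⟩, hq1, hq2⟩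
      · exact .inl (.inr (.inr hq2))
    · exact .inl (.inr (.inl hq1))
  calc P' T ≤ P' (N ∪ (Prod.fst ⁻¹' E₁ᶜ ∪ Prod.snd ⁻¹' E₂ᶜ) ∪ B) := measure_mono hcover
    _ ≤ P' (N ∪ (Prod.fst ⁻¹' E₁ᶜ ∪ Prod.snd ⁻¹' E₂ᶜ)) + P' B := measure_union_le _ _
    _ ≤ P' N + (K⁻¹ + K⁻¹) := by
      rw [h5, add_zero]
      exact (measure_union_le _ _).trans (add_le_add le_rfl
        ((measure_union_le _ _).trans (add_le_add hbad₁ hbad₂)))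

/-- Both laws generate the last coordinate by the same kernel `L`, so the density of the first two
coordinates is already the density of the full laws. -/
theorem setLIntegral_rnDeriv_compProd (μ : Measure α) [IsProbabilityMeasure μ]
    (Q Q' : Kernel α β) [IsMarkovKernel Q] [IsMarkovKernel Q'] (hac : μ ⊗ₘ Q' ≪ μ ⊗ₘ Q)
    (L : Kernel (α × β) γ) [IsMarkovKernel L] {B : Set (α × β × γ)} (hB : MeasurableSet B) :
    ∫⁻ q in B, (μ ⊗ₘ Q').rnDeriv (μ ⊗ₘ Q) (q.1, q.2.1) ∂(μ ⊗ₘ (Q ⊗ₖ L)) =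
      (μ ⊗ₘ (Q' ⊗ₖ L)) B := by
  set h := (μ ⊗ₘ Q').rnDeriv (μ ⊗ₘ Q)
  have hh : Measurable h := Measure.measurable_rnDeriv _ _
  have hh' : Measurable fun q : α × β × γ => h (q.1, q.2.1) := hh.comp (by fun_prop)
  have hind : Measurable (B.indicator fun _ => (1 : ℝ≥0∞)) := measurable_one.indicator hB
  -- Reassociates the integral so that the pair `(a, b)` is integrated last, which is where the
  -- density lives.
  have key : ∀ (R : Kernel α β) [IsMarkovKernel R] (f : α × β × γ → ℝ≥0∞), Measurable f →
      ∫⁻ q, f q ∂(μ ⊗ₘ (R ⊗ₖ L)) =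
        ∫⁻ z, ∫⁻ u, f (z.1, z.2, u) ∂(L z) ∂(μ ⊗ₘ R) := by
    intro R _ f hf
    have hfm : Measurable fun z : (α × β) × γ => f (z.1.1, z.1.2, z.2) := hf.comp (by fun_prop)
    rw [Measure.lintegral_compProd hf, Measure.lintegral_compProd hfm.lintegral_kernel_prod_right']
    refine lintegral_congr fun a => ?_
    exact Kernel.lintegral_compProd _ _ _ (hf.comp measurable_prodMk_left)
  have hGm : Measurable fun z : α × β => ∫⁻ u, B.indicator (fun _ => (1 : ℝ≥0∞)) (z.1, z.2, u) ∂(L z) :=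
    Measurable.lintegral_kernel_prod_right' (f := fun z : (α × β) × γ =>
      B.indicator (fun _ => (1 : ℝ≥0∞)) (z.1.1, z.1.2, z.2)) (hind.comp (by fun_prop))
  rw [← lintegral_indicator hB, ← lintegral_indicator_one hB]
  change _ = ∫⁻ q, B.indicator (fun _ => (1 : ℝ≥0∞)) q ∂(μ ⊗ₘ (Q' ⊗ₖ L))
  rw [key Q' _ hind, key Q _ (hh'.indicator hB)]
  conv_rhs => rw [← Measure.withDensity_rnDeriv_eq _ _ hac]
  rw [lintegral_withDensity_eq_lintegral_mul _ hh hGm]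
  refine lintegral_congr fun z => ?_
  refine Eq.trans ?_ (lintegral_const_mul _ (hind.comp
    (f := fun u : γ => (z.1, z.2, u)) (by fun_prop)))
  refine lintegral_congr fun u => ?_
  by_cases hz : (z.1, z.2, u) ∈ B <;> simp [hz]

/-- Puts the product reference law in the form of a composition, so that the change of measure
applies to it too. -/
theorem prod_eq_compProd_prodMkRight (Q : Kernel α β) [IsMarkovKernel Q]
    (V : Kernel α γ) [IsMarkovKernel V] :
    Q ×ₖ V = Q ⊗ₖ Kernel.prodMkRight β V := by
  ext a s hs
  rw [Kernel.prod_apply' _ _ _ hs, Kernel.compProd_apply hs]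
  rfl

/-- If `Q'` is dominated by `w⁻¹ Q`, then the conditional information density of `(Q, L)` is not
much larger than that of `(Q', L)` with high probability under `(Q', L)`. -/
theorem measure_lt_condInfoRatio_le (μ : Measure α) [IsProbabilityMeasure μ]
    (Q Q' : Kernel α β) [IsMarkovKernel Q] [IsMarkovKernel Q']
    (L : Kernel (α × β) γ) [IsMarkovKernel L] {w c c' : ℝ≥0∞} (hw : w ≠ 0)
    (hQ : ∀ a, w • Q' a ≤ Q a) (hc' : c' ≠ ∞) (hlt : c' < c * w) :
    (μ ⊗ₘ (Q' ⊗ₖ L)) {q | c < likelihoodRatio (μ ⊗ₘ (Q ⊗ₖ L))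
        (μ ⊗ₘ ((Q ⊗ₖ L).fst ×ₖ (Q ⊗ₖ L).snd)) q} ≤
      (μ ⊗ₘ (Q' ⊗ₖ L)) {q | c' < likelihoodRatio (μ ⊗ₘ (Q' ⊗ₖ L))
        (μ ⊗ₘ ((Q' ⊗ₖ L).fst ×ₖ (Q' ⊗ₖ L).snd)) q} := by
  rw [Kernel.fst_compProd, Kernel.fst_compProd]
  set T := {q | c < likelihoodRatio (μ ⊗ₘ (Q ⊗ₖ L)) (μ ⊗ₘ (Q ×ₖ (Q ⊗ₖ L).snd)) q}
  set N := {q | c' < likelihoodRatio (μ ⊗ₘ (Q' ⊗ₖ L)) (μ ⊗ₘ (Q' ×ₖ (Q' ⊗ₖ L).snd)) q}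
  have hT : MeasurableSet T := measurable_likelihoodRatio _ _ measurableSet_Ioi
  have hN : MeasurableSet N := measurable_likelihoodRatio _ _ measurableSet_Ioi
  have hac : μ ⊗ₘ Q' ≪ μ ⊗ₘ Q := Measure.AbsolutelyContinuous.compProd_right
    (.of_forall fun a s hs => by
      have h1 : w * Q' a s ≤ Q a s := hQ a s
      rw [hs, nonpos_iff_eq_zero] at h1
      exact (mul_eq_zero.1 h1).resolve_left hw)
  set B := T ∩ Nᶜ
  have hB : MeasurableSet B := hT.inter hN.compl
  have h1 : (μ ⊗ₘ (Q' ⊗ₖ L)) B ≤ c' * (μ ⊗ₘ (Q' ×ₖ (Q' ⊗ₖ L).snd)) B :=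
    measure_le_of_likelihoodRatio_le _ _ hc' hB fun q hq => not_lt.1 hq.2
  -- The bound on `T` holds on every measurable subset of `B`, hence can be integrated against the
  -- density of `Q'` with respect to `Q`. This replaces `Q` by `Q'` but keeps the mixed law of the
  -- last coordinate.
  have h2 : c * (μ ⊗ₘ (Q' ×ₖ (Q ⊗ₖ L).snd)) B ≤ (μ ⊗ₘ (Q' ⊗ₖ L)) B := by
    rw [prod_eq_compProd_prodMkRight Q', ← setLIntegral_rnDeriv_compProd μ Q Q' hac L hB,
      ← setLIntegral_rnDeriv_compProd μ Q Q' hac _ hB, ← prod_eq_compProd_prodMkRight Q,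
      ← smul_eq_mul, ← lintegral_smul_measure]
    refine lintegral_mono' (Measure.le_iff.2 fun s hs => ?_) le_rfl
    rw [Measure.smul_apply, Measure.restrict_apply hs, Measure.restrict_apply hs, smul_eq_mul]
    exact le_measure_of_le_likelihoodRatio _ _ (hs.inter hB) fun q hq => le_of_lt hq.2.1
  -- Domination passes to the law of the last coordinate, the one remaining trace of `Q`.
  have h3 : w * (μ ⊗ₘ (Q' ×ₖ (Q' ⊗ₖ L).snd)) B ≤ (μ ⊗ₘ (Q' ×ₖ (Q ⊗ₖ L).snd)) B := by
    have hsnd : ∀ a, w • (Q' ⊗ₖ L).snd a ≤ (Q ⊗ₖ L).snd a := fun a =>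
      Measure.le_iff.2 fun s hs => by
        rw [Measure.smul_apply, Kernel.snd_apply' _ _ hs, Kernel.snd_apply' _ _ hs,
          Kernel.compProd_apply (measurable_snd hs), Kernel.compProd_apply (measurable_snd hs),
          ← lintegral_smul_measure]
        exact lintegral_mono' (hQ a) le_rfl
    rw [Measure.compProd_apply hB, Measure.compProd_apply hB,
      ← lintegral_const_mul _ (Kernel.measurable_kernel_prodMk_left hB)]
    refine lintegral_mono fun a => ?_
    have hBa : MeasurableSet (Prod.mk a ⁻¹' B) := measurable_prodMk_left hB
    rw [Kernel.prod_apply' _ _ _ hBa, Kernel.prod_apply' _ _ _ hBa,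
      ← lintegral_const_mul _ (measurable_measure_prodMk_left hBa)]
    exact lintegral_mono fun b => hsnd a _
  have h4 : (μ ⊗ₘ (Q' ×ₖ (Q' ⊗ₖ L).snd)) B = 0 := by
    refine measure_eq_zero_of_mul_le_mul hlt ?_
    rw [mul_assoc]
    exact (mul_le_mul_right h3 _).trans (h2.trans h1)
  have h5 : (μ ⊗ₘ (Q' ⊗ₖ L)) B = 0 := by simpa [h4] using h1
  calc (μ ⊗ₘ (Q' ⊗ₖ L)) T ≤ (μ ⊗ₘ (Q' ⊗ₖ L)) (N ∪ B) := measure_mono fun q hq => by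
        by_cases hqN : q ∈ N
        · exact .inl hqN
        · exact .inr ⟨hq, hqN⟩
    _ ≤ (μ ⊗ₘ (Q' ⊗ₖ L)) N + (μ ⊗ₘ (Q' ⊗ₖ L)) B := measure_union_le _ _
    _ = _ := by rw [h5, add_zero]

end Comparison

end ISAC

namespace ISAC

/-! ### Linearity of kernel composition in each factor -/

section Mixtures

variable {α β γ : Type u} [MeasurableSpace α] [MeasurableSpace β] [MeasurableSpace γ]
  {ι : Type*} [Fintype ι] {w : ι → ℝ≥0∞}

theorem compProd_eq_sum_smul_left {κ : Kernel α β} {κ' : ι → Kernel α β} [IsSFiniteKernel κ]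
    [∀ i, IsSFiniteKernel (κ' i)] (hκ : ∀ a, κ a = ∑ i, w i • κ' i a) (η : Kernel (α × β) γ)
    [IsSFiniteKernel η] (a : α) : (κ ⊗ₖ η) a = ∑ i, w i • (κ' i ⊗ₖ η) a := by
  ext B hB
  rw [Measure.finsetSum_apply]
  simp_rw [Measure.smul_apply, Kernel.compProd_apply hB, hκ a, lintegral_finsetSum_measure,
    lintegral_smul_measure]

theorem compProd_eq_sum_smul_right (κ : Kernel α β) [IsSFiniteKernel κ] {η : Kernel (α × β) γ}
    {η' : ι → Kernel (α × β) γ} [IsSFiniteKernel η] [∀ i, IsSFiniteKernel (η' i)]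
    (hη : ∀ q, η q = ∑ i, w i • η' i q) (a : α) :
    (κ ⊗ₖ η) a = ∑ i, w i • (κ ⊗ₖ η' i) a := by
  ext B hB
  have hm : ∀ i, Measurable fun b => η' i (a, b) (Prod.mk b ⁻¹' B) := fun i =>
    Kernel.measurable_kernel_prodMk_left' hB a
  simp_rw [Measure.finsetSum_apply, Measure.smul_apply, Kernel.compProd_apply hB, hη,
    Measure.finsetSum_apply, Measure.smul_apply, smul_eq_mul]
  rw [lintegral_finsetSum _ fun i _ => (hm i).const_mul _]
  exact Finset.sum_congr rfl fun i _ => lintegral_const_mul _ (hm i)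

theorem compProd_eq_sum_smul (μ : Measure α) [SFinite μ] {κ : Kernel α β} {κ' : ι → Kernel α β}
    [IsSFiniteKernel κ] [∀ i, IsSFiniteKernel (κ' i)] (hκ : ∀ a, κ a = ∑ i, w i • κ' i a) :
    μ ⊗ₘ κ = ∑ i, w i • (μ ⊗ₘ κ' i) := by
  ext B hB
  have hm : ∀ i, Measurable fun a => κ' i a (Prod.mk a ⁻¹' B) := fun i =>
    Kernel.measurable_kernel_prodMk_left hB
  simp_rw [Measure.finsetSum_apply, Measure.smul_apply, Measure.compProd_apply hB, hκ,
    Measure.finsetSum_apply, Measure.smul_apply, smul_eq_mul]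
  rw [lintegral_finsetSum _ fun i _ => (hm i).const_mul _]
  exact Finset.sum_congr rfl fun i _ => lintegral_const_mul _ (hm i)

end Mixtures

/-! ### Spectral rates of mixtures and of independent pairs -/

section Rates

theorem tendsto_measure_lt_of_lt_pLiminf {Ω : ℕ → Type u} [∀ n, MeasurableSpace (Ω n)]
    {μ : ∀ n, Measure (Ω n)} {Z : ∀ n, Ω n → EReal} {b : EReal} (hb : b < pLiminf μ Z) :
    Tendsto (fun n => μ n {ω | Z n ω < b}) atTop (𝓝 0) := by
  obtain ⟨c, hc, hbc⟩ := lt_sSup_iff.1 hb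
  exact tendsto_of_tendsto_of_tendsto_of_le_of_le tendsto_const_nhds hc (fun n => zero_le)
    fun n => measure_mono fun ω (hω : _ < _) => hω.trans hbc

theorem tendsto_measure_gt_of_pLimsup_lt {Ω : ℕ → Type u} [∀ n, MeasurableSpace (Ω n)]
    {μ : ∀ n, Measure (Ω n)} {Z : ∀ n, Ω n → EReal} {a : EReal} (ha : pLimsup μ Z < a) :
    Tendsto (fun n => μ n {ω | a < Z n ω}) atTop (𝓝 0) := by
  obtain ⟨c, hc, hca⟩ := sInf_lt_iff.1 ha
  exact tendsto_of_tendsto_of_tendsto_of_le_of_le tendsto_const_nhds hc (fun n => zero_le)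
    fun n => measure_mono fun ω (hω : _ < _) => hca.trans hω

theorem tendsto_ofReal_exp_neg {γ : ℝ} (hγ : 0 < γ) :
    Tendsto (fun n : ℕ => ENNReal.ofReal (Real.exp (-(n * γ)))) atTop (𝓝 0) := by
  rw [← ENNReal.ofReal_zero]
  exact ENNReal.tendsto_ofReal (Real.tendsto_exp_neg_atTop_nhds_zero.comp
    (tendsto_natCast_atTop_atTop.atTop_mul_const hγ))

/-- Convergence is asked only where the weight is nonzero: a component of weight zero is not
dominated by the mixture, but contributes nothing. -/
theorem tendsto_sum_mul_of_tendsto_zero {ι : Type*} [Fintype ι] {w : ι → ℝ≥0∞}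
    (hw : ∀ i, w i ≠ ∞) {f : ι → ℕ → ℝ≥0∞}
    (hf : ∀ i, w i ≠ 0 → Tendsto (f i) atTop (𝓝 0)) :
    Tendsto (fun n => ∑ i, w i * f i n) atTop (𝓝 0) := by
  rw [show (0 : ℝ≥0∞) = ∑ _i : ι, 0 by simp]
  refine tendsto_finsetSum _ fun i _ => ?_
  by_cases h0 : w i = 0
  · simp [h0]
  · simpa using ENNReal.Tendsto.const_mul (hf i h0) (.inr (hw i))

/-- The spectral inf-mutual information rate of a mixture is at least the smallest one among its
components. -/
theorem iInf_infMutualInfoRate_le {α β : ℕ → Type u} [∀ n, MeasurableSpace (α n)]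
    [∀ n, MeasurableSpace (β n)] {ι : Type*} [Fintype ι] {w : ι → ℝ≥0∞} (hw : ∀ i, w i ≠ ∞)
    (P : ∀ n, Measure (α n × β n)) (P' : ι → ∀ n, Measure (α n × β n))
    [∀ n, IsProbabilityMeasure (P n)] [∀ i n, IsProbabilityMeasure (P' i n)]
    (hP : ∀ n, P n = ∑ i, w i • P' i n) :
    ⨅ i, infMutualInfoRate (P' i) ≤ infMutualInfoRate P := by
  refine EReal.ge_of_forall_gt_iff_ge.1 fun b hb => ?_
  obtain ⟨b', hbb', hb'⟩ := EReal.lt_iff_exists_real_btwn.1 hb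
  have hlt : b < b' := by exact_mod_cast hbb'
  refine le_sSup (Set.mem_ofPred_eq ▸ ?_)
  set Z : ∀ n, α n × β n → EReal := fun n q => ((1 / n : ℝ) : EReal) * infoDensity (P n) q
  have hsum : ∀ n, P n {q | Z n q < b} = ∑ i, w i * P' i n {q | Z n q < b} := fun n => by
    conv_lhs => rw [hP n]
    simp
  simp_rw [hsum]
  refine tendsto_sum_mul_of_tendsto_zero hw fun i hi => ?_
  -- The gap `4γ` pays `2γ` for the two marginal factors `K = exp (n γ)` and `γ` for the weight,
  -- which eventually exceeds `exp (-n γ)`; `γ` is left over.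
  set γ := (b' - b) / 4 with hγdef
  have hγ : 0 < γ := by positivity [sub_pos.2 hlt]
  have hi' := tendsto_measure_lt_of_lt_pLiminf (hb'.trans_le (iInf_le _ i))
  have hE := tendsto_ofReal_exp_neg hγ
  have hup := hi'.add (hE.add hE)
  simp only [add_zero] at hup
  refine tendsto_of_tendsto_of_tendsto_of_le_of_le' tendsto_const_nhds hup
    (.of_forall fun n => zero_le) ?_
  filter_upwards [eventually_ne_atTop 0,
    hE.eventually_lt_const (pos_iff_ne_zero.2 hi)] with n hn hnw
  have hPP' : w i • P' i n ≤ P n := by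
    rw [hP n]
    exact Finset.single_le_sum (f := fun i => w i • P' i n) (fun _ _ => Measure.zero_le _)
      (Finset.mem_univ i)
  have hcmp := measure_infoRatio_lt_le (P n) (P' i n) hi hPP'
    (c := ENNReal.ofReal (Real.exp (n * b))) (c' := ENNReal.ofReal (Real.exp (n * b')))
    (K := ENNReal.ofReal (Real.exp (n * γ))) ENNReal.ofReal_ne_top ENNReal.ofReal_ne_top (by
      have hn0 : (0 : ℝ) < n := by positivity
      have hpos : ENNReal.ofReal (Real.exp (n * b')) ≠ 0 := by simp [Real.exp_pos]
      refine lt_of_le_of_lt ?_ (ENNReal.mul_lt_mul_left hpos ENNReal.ofReal_ne_top hnw)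
      rw [← ENNReal.ofReal_mul (Real.exp_pos _).le, ← ENNReal.ofReal_mul (Real.exp_pos _).le,
        ← ENNReal.ofReal_mul (Real.exp_pos _).le, ← Real.exp_add, ← Real.exp_add, ← Real.exp_add]
      refine ENNReal.ofReal_le_ofReal (Real.exp_le_exp.2 ?_)
      have : b' = b + 4 * γ := by rw [hγdef]; ring
      rw [this]
      nlinarith [mul_pos hn0 hγ])
  rw [← ENNReal.ofReal_inv_of_pos (Real.exp_pos _), ← Real.exp_neg] at hcmp
  simpa only [Z, infoDensity, scaled_log_lt_iff hn] using hcmp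

/-- The spectral sup-conditional mutual information rate of `(X, Y)` given `A`, for a mixture of
conditional laws of `X` given `A` and a common conditional law of `Y` given `(A, X)`, is at most
the largest one among the components. -/
theorem supCondMutualInfoRate_le_iSup {α β γ : ℕ → Type u} [∀ n, MeasurableSpace (α n)]
    [∀ n, MeasurableSpace (β n)] [∀ n, MeasurableSpace (γ n)] {ι : Type*} [Fintype ι]
    {w : ι → ℝ≥0∞} (hw : ∀ i, w i ≠ ∞) (μ : ∀ n, Measure (α n)) [∀ n, IsProbabilityMeasure (μ n)]
    (Q : ∀ n, Kernel (α n) (β n)) (Q' : ι → ∀ n, Kernel (α n) (β n))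
    (L : ∀ n, Kernel (α n × β n) (γ n)) [∀ n, IsMarkovKernel (Q n)]
    [∀ i n, IsMarkovKernel (Q' i n)] [∀ n, IsMarkovKernel (L n)]
    (hQ : ∀ n a, Q n a = ∑ i, w i • Q' i n a) :
    supCondMutualInfoRate μ (fun n => Q n ⊗ₖ L n) ≤
      ⨆ i, supCondMutualInfoRate μ (fun n => Q' i n ⊗ₖ L n) := by
  refine EReal.le_of_forall_lt_iff_le.1 fun a ha => ?_
  obtain ⟨a', ha', haa'⟩ := EReal.lt_iff_exists_real_btwn.1 ha
  have hlt : a' < a := by exact_mod_cast haa'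
  refine sInf_le (Set.mem_ofPred_eq ▸ ?_)
  set Z : ∀ n, α n × β n × γ n → EReal :=
    fun n q => ((1 / n : ℝ) : EReal) * condInfoDensity (μ n) (Q n ⊗ₖ L n) q
  have hsum : ∀ n (B : Set (α n × β n × γ n)),
      (μ n ⊗ₘ (Q n ⊗ₖ L n)) B = ∑ i, w i * (μ n ⊗ₘ (Q' i n ⊗ₖ L n)) B := fun n B => by
    rw [compProd_eq_sum_smul (μ n) (compProd_eq_sum_smul_left (hQ n) (L n))]
    simp
  simp_rw [hsum]
  refine tendsto_sum_mul_of_tendsto_zero hw fun i hi => ?_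
  have hi' := tendsto_measure_gt_of_pLimsup_lt ((le_iSup _ i).trans_lt ha')
  refine tendsto_of_tendsto_of_tendsto_of_le_of_le' tendsto_const_nhds hi'
    (.of_forall fun n => zero_le) ?_
  filter_upwards [eventually_ne_atTop 0, (tendsto_ofReal_exp_neg (sub_pos.2 hlt)).eventually_lt_const
    (pos_iff_ne_zero.2 hi)] with n hn hnw
  have hcmp := measure_lt_condInfoRatio_le (μ n) (Q n) (Q' i n) (L n) hi (fun a => by
      rw [hQ n a]
      exact Finset.single_le_sum (f := fun i => w i • Q' i n a) (fun _ _ => Measure.zero_le _)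
        (Finset.mem_univ i))
    (c := ENNReal.ofReal (Real.exp (n * a))) (c' := ENNReal.ofReal (Real.exp (n * a')))
    ENNReal.ofReal_ne_top (by
      have hpos : ENNReal.ofReal (Real.exp (n * a)) ≠ 0 := by simp [Real.exp_pos]
      refine lt_of_le_of_lt ?_ (ENNReal.mul_lt_mul_right hpos ENNReal.ofReal_ne_top hnw)
      rw [← ENNReal.ofReal_mul (Real.exp_pos _).le, ← Real.exp_add]
      exact ENNReal.ofReal_le_ofReal (Real.exp_le_exp.2 (le_of_eq (by ring))))
  simpa only [Z, condInfoDensity, lt_scaled_log_iff hn] using hcmp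

/-- Independent pairs have spectral inf-mutual information rate at most zero. -/
theorem infMutualInfoRate_nonpos_of_indep {α β : ℕ → Type u} [∀ n, MeasurableSpace (α n)]
    [∀ n, MeasurableSpace (β n)] (P : ∀ n, Measure (α n × β n)) [∀ n, IsProbabilityMeasure (P n)]
    (hP : ∀ n, (P n).fst.prod (P n).snd = P n) : infMutualInfoRate P ≤ 0 := by
  refine sSup_le fun b hb => ?_
  by_contra! hb0
  obtain ⟨b', hb'0, hb'⟩ := EReal.lt_iff_exists_real_btwn.1 hb0
  have hpos : 0 < b' := by exact_mod_cast hb'0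
  -- Under independence the density vanishes almost surely, so a positive threshold gives events of
  -- probability one, which cannot tend to zero.
  have hone : ∀ᶠ n : ℕ in atTop,
      P n {q | ((1 / n : ℝ) : EReal) * infoDensity (P n) q < b} = 1 := by
    filter_upwards [eventually_ne_atTop 0] with n hn
    refine le_antisymm prob_le_one ?_
    have h0 := measure_le_likelihoodRatio_self (P n) (c := ENNReal.ofReal (Real.exp (n * b')))
      (ENNReal.one_lt_ofReal.2 (Real.one_lt_exp_iff.2 (by positivity)))
    have h1 : P n {q | likelihoodRatio (P n) (P n) q < ENNReal.ofReal (Real.exp (n * b'))} = 1 := by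
      change P n (likelihoodRatio (P n) (P n) ⁻¹' Set.Iio _) = 1
      rw [← prob_compl_eq_zero_iff (measurable_likelihoodRatio _ _ measurableSet_Iio), ← h0]
      congr 1
      ext q
      simp
    rw [← h1]
    refine measure_mono fun q hq => ?_
    refine lt_trans ?_ hb'
    rw [infoDensity, scaled_log_lt_iff hn, hP n]
    exact hq
  exact zero_ne_one (tendsto_nhds_unique hb
    (tendsto_const_nhds.congr' (hone.mono fun n hn => hn.symm)))

/-- Spectral sup-conditional mutual information rates of conditionally independent pairs are
nonnegative. -/
theorem supCondMutualInfoRate_nonneg_of_condIndep {α β γ : ℕ → Type u}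
    [∀ n, MeasurableSpace (α n)] [∀ n, MeasurableSpace (β n)] [∀ n, MeasurableSpace (γ n)]
    (μ : ∀ n, Measure (α n)) [∀ n, IsProbabilityMeasure (μ n)]
    (κ : ∀ n, Kernel (α n) (β n × γ n)) [∀ n, IsMarkovKernel (κ n)]
    (hκ : ∀ n, (κ n).fst ×ₖ (κ n).snd = κ n) : 0 ≤ supCondMutualInfoRate μ κ := by
  refine le_sInf fun a ha => ?_
  by_contra! ha0
  obtain ⟨a', ha', ha'0⟩ := EReal.lt_iff_exists_real_btwn.1 ha0
  have hneg : a' < 0 := by exact_mod_cast ha'0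
  have hone : ∀ᶠ n : ℕ in atTop, (μ n ⊗ₘ κ n)
      {q | a < ((1 / n : ℝ) : EReal) * condInfoDensity (μ n) (κ n) q} = 1 := by
    filter_upwards [eventually_ne_atTop 0] with n hn
    refine le_antisymm prob_le_one ?_
    set M := μ n ⊗ₘ κ n
    have hn0 : (0 : ℝ) < n := by positivity
    have h0 := measure_likelihoodRatio_self_le M (c := ENNReal.ofReal (Real.exp (n * a')))
      (by rw [ENNReal.ofReal_lt_one, Real.exp_lt_one_iff]; exact mul_neg_of_pos_of_neg hn0 hneg)
    have h1 : M {q | ENNReal.ofReal (Real.exp (n * a')) < likelihoodRatio M M q} = 1 := by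
      change M (likelihoodRatio M M ⁻¹' Set.Ioi _) = 1
      rw [← prob_compl_eq_zero_iff (measurable_likelihoodRatio _ _ measurableSet_Ioi), ← h0]
      congr 1
      ext q
      simp
    rw [← h1]
    refine measure_mono fun q hq => ?_
    refine lt_trans ha' ?_
    rw [condInfoDensity, lt_scaled_log_iff hn, hκ n]
    exact hq
  exact zero_ne_one (tendsto_nhds_unique ha
    (tendsto_const_nhds.congr' (hone.mono fun n hn => hn.symm)))

end Rates

end ISAC

/-! ### Processes on the mixed model -/

namespace ISAC

theorem lintegral_dirac_compProd {α β : Type u} [MeasurableSpace α] [MeasurableSpace β] (a : α)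
    (κ : Kernel α β) [IsSFiniteKernel κ] {f : α × β → ℝ≥0∞} (hf : Measurable f) :
    ∫⁻ q, f q ∂(Measure.dirac a ⊗ₘ κ) = ∫⁻ b, f (a, b) ∂(κ a) := by
  rw [Measure.lintegral_compProd hf]
  exact lintegral_dirac' _ hf.lintegral_kernel_prod_right'

theorem dirac_compProd_eq_map {α β : Type u} [MeasurableSpace α] [MeasurableSpace β] (a : α)
    (κ : Kernel α β) [IsSFiniteKernel κ] :
    Measure.dirac a ⊗ₘ κ = (κ a).map (Prod.mk a) :=
  Measure.ext_of_lintegral _ fun f hf => by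
    rw [lintegral_dirac_compProd a κ hf, lintegral_map hf measurable_prodMk_left]

/-- The only loss in the distortion estimate: expectations are exactly linear in the mixture, but
their limsups are merely subadditive. -/
theorem limsup_add_le_limsup_add_limsup (u v : ℕ → ℝ≥0∞) :
    limsup (fun n => u n + v n) atTop ≤ limsup u atTop + limsup v atTop := by
  refine ENNReal.le_of_forall_pos_le_add fun ε hε hfin => ?_
  have hε' : (ε / 2 : ℝ≥0∞) ≠ 0 := by simpa using hε.ne'
  obtain ⟨hu, hv⟩ := ENNReal.add_lt_top.1 hfin
  refine limsup_le_of_le (h := ?_)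
  filter_upwards [eventually_lt_of_limsup_lt (ENNReal.lt_add_right hu.ne hε'),
    eventually_lt_of_limsup_lt (ENNReal.lt_add_right hv.ne hε')] with n hun hvn
  refine (add_le_add hun.le hvn.le).trans (le_of_eq ?_)
  rw [add_add_add_comm, ENNReal.add_halves]

theorem limsup_finsetSum_le {ι : Type*} (s : Finset ι) (u : ι → ℕ → ℝ≥0∞) :
    limsup (fun n => ∑ i ∈ s, u i n) atTop ≤ ∑ i ∈ s, limsup (u i) atTop := by
  classical
  induction s using Finset.induction_on with
  | empty => simp
  | insert i s hi ih =>
    simp_rw [Finset.sum_insert hi]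
    exact (limsup_add_le_limsup_add_limsup _ _).trans (add_le_add le_rfl ih)

variable {𝒜 𝒳 𝒮e 𝒮 𝒮d 𝒴 𝒵 𝒮hat : Type u}
  [MeasurableSpace 𝒜] [MeasurableSpace 𝒳] [MeasurableSpace 𝒮e] [MeasurableSpace 𝒮]
  [MeasurableSpace 𝒮d] [MeasurableSpace 𝒴] [MeasurableSpace 𝒵] [MeasurableSpace 𝒮hat]

namespace InputProcess

variable (p : InputProcess 𝒜 𝒳 𝒮e 𝒵 𝒮hat)

instance isProbabilityMeasure_jointLaw (Q : StateLaw 𝒜 𝒮e 𝒮 𝒮d) (W : Channel 𝒳 𝒮 𝒴 𝒵)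
    [∀ n, IsMarkovKernel (Q n)] [∀ n, IsMarkovKernel (W n)] (n : ℕ) :
    IsProbabilityMeasure (p.jointLaw Q W n) := by
  unfold jointLaw; infer_instance

instance isProbabilityMeasure_lawAUSdY (Q : StateLaw 𝒜 𝒮e 𝒮 𝒮d) (W : Channel 𝒳 𝒮 𝒴 𝒵)
    [∀ n, IsMarkovKernel (Q n)] [∀ n, IsMarkovKernel (W n)] (n : ℕ) :
    IsProbabilityMeasure (p.lawAUSdY Q W n) :=
  Measure.isProbabilityMeasure_map (by fun_prop)

instance isMarkovKernel_condLawSeU (Q : StateLaw 𝒜 𝒮e 𝒮 𝒮d) [∀ n, IsMarkovKernel (Q n)] (n : ℕ) :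
    IsMarkovKernel (p.condLawSeU Q n) := by
  unfold condLawSeU; infer_instance

theorem lintegral_jointLaw_of_lawA_eq_dirac (Q : StateLaw 𝒜 𝒮e 𝒮 𝒮d) (W : Channel 𝒳 𝒮 𝒴 𝒵)
    [∀ n, IsMarkovKernel (Q n)] [∀ n, IsMarkovKernel (W n)] (n : ℕ)
    {a : Seq n 𝒜} (ha : p.lawA n = Measure.dirac a)
    {f : p.Outcome 𝒮 𝒮d 𝒴 n → ℝ≥0∞} (hf : Measurable f) :
    ∫⁻ ω, f ω ∂(p.jointLaw Q W n) =
      ∫⁻ s, ∫⁻ u, ∫⁻ x, ∫⁻ y, f (a, (((s, u), x), y)) ∂(W n (x, s.2.1))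
        ∂(p.lawX n (u, s.1)) ∂(p.lawU n (a, s.1)) ∂(Q n a) := by
  unfold jointLaw
  rw [ha, lintegral_dirac_compProd a _ hf]
  have hfa : Measurable fun b => f (a, b) := hf.comp measurable_prodMk_left
  rw [Kernel.lintegral_compProd _ _ _ hfa]
  have h1 : Measurable fun q : (Seq n 𝒜 × (((Seq n 𝒮e × Seq n 𝒮 × Seq n 𝒮d) × Seq n p.𝒰) × Seq n 𝒳))
      × (Seq n 𝒴 × Seq n 𝒵) => f (q.1.1, (q.1.2, q.2)) := hf.comp (by fun_prop)
  have h1' := h1.lintegral_kernel_prod_right'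
    (κ := (W n).comap
        (fun q : Seq n 𝒜 × (((Seq n 𝒮e × Seq n 𝒮 × Seq n 𝒮d) × Seq n p.𝒰) × Seq n 𝒳) =>
          (q.2.2, q.2.1.1.2.1)) (by fun_prop))
  refine (Kernel.lintegral_compProd _ _ _ (h1'.comp measurable_prodMk_left)).trans ?_
  have h2' := Measurable.lintegral_kernel_prod_right' (κ := (p.lawX n).comap
        (fun q : Seq n 𝒜 × ((Seq n 𝒮e × Seq n 𝒮 × Seq n 𝒮d) × Seq n p.𝒰) => (q.2.2, q.2.1.1))
        (by fun_prop)) (f := fun q => ∫⁻ y, f (q.1.1, ((q.1.2, q.2), y)) ∂(W n (q.2, q.1.2.1.2.1)))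
      (h1'.comp (f := fun q : (Seq n 𝒜 × ((Seq n 𝒮e × Seq n 𝒮 × Seq n 𝒮d) × Seq n p.𝒰)) × Seq n 𝒳 =>
        (q.1.1, (q.1.2, q.2))) (by fun_prop))
  exact Kernel.lintegral_compProd _ _ _ (h2'.comp measurable_prodMk_left)

theorem jointLaw_mix {α β : Fin 2 → ℝ≥0} (hα : α 0 + α 1 = 1) (hβ : β 0 + β 1 = 1)
    (Q : Fin 2 → StateLaw 𝒜 𝒮e 𝒮 𝒮d) [∀ i n, IsMarkovKernel (Q i n)]
    (W : Fin 2 → Channel 𝒳 𝒮 𝒴 𝒵) [∀ j n, IsMarkovKernel (W j n)] (n : ℕ) :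
    p.jointLaw (fun n => mix α fun i => Q i n) (fun n => mix β fun j => W j n) n =
      ∑ k : Fin 2 × Fin 2, ((α k.1 : ℝ≥0∞) * β k.2) • p.jointLaw (Q k.1) (W k.2) n := by
  have hQ : ∀ n, IsMarkovKernel (mix α fun i => Q i n) := fun n => isMarkovKernel_mix hα _
  have hW : ∀ n, IsMarkovKernel (mix β fun j => W j n) := fun n => isMarkovKernel_mix hβ _
  -- The state mixture sits innermost and is carried outwards through the kernels for `U` and `X`;
  -- the channel mixture is then expanded on the outside.
  have hstate := fun a => compProd_eq_sum_smul_left (w := fun i => (α i : ℝ≥0∞))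
    (compProd_eq_sum_smul_left (κ := mix α fun i => Q i n) (κ' := fun i => Q i n) (fun _ => rfl)
      ((p.lawU n).comap
        (fun q : Seq n 𝒜 × (Seq n 𝒮e × Seq n 𝒮 × Seq n 𝒮d) => (q.1, q.2.1)) (by fun_prop)))
    ((p.lawX n).comap
      (fun q : Seq n 𝒜 × ((Seq n 𝒮e × Seq n 𝒮 × Seq n 𝒮d) × Seq n p.𝒰) => (q.2.2, q.2.1.1))
      (by fun_prop)) a
  refine (compProd_eq_sum_smul (p.lawA n) fun a => ?_).trans rfl
  rw [compProd_eq_sum_smul_right _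
    (η' := fun j => (W j n).comap
      (fun q : Seq n 𝒜 × (((Seq n 𝒮e × Seq n 𝒮 × Seq n 𝒮d) × Seq n p.𝒰) × Seq n 𝒳) =>
        (q.2.2, q.2.1.1.2.1)) (by fun_prop))
    (w := fun j => (β j : ℝ≥0∞)) (fun _ => rfl)]
  simp_rw [compProd_eq_sum_smul_left hstate, Finset.smul_sum, smul_smul]
  rw [Finset.sum_comm, ← Fintype.sum_prod_type']
  simp_rw [mul_comm]

theorem lawAUSdY_mix {α β : Fin 2 → ℝ≥0} (hα : α 0 + α 1 = 1) (hβ : β 0 + β 1 = 1)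
    (Q : Fin 2 → StateLaw 𝒜 𝒮e 𝒮 𝒮d) [∀ i n, IsMarkovKernel (Q i n)]
    (W : Fin 2 → Channel 𝒳 𝒮 𝒴 𝒵) [∀ j n, IsMarkovKernel (W j n)] (n : ℕ) :
    p.lawAUSdY (fun n => mix α fun i => Q i n) (fun n => mix β fun j => W j n) n =
      ∑ k : Fin 2 × Fin 2, ((α k.1 : ℝ≥0∞) * β k.2) • p.lawAUSdY (Q k.1) (W k.2) n := by
  have hm : Measurable fun ω : p.Outcome 𝒮 𝒮d 𝒴 n =>
      ((ω.1, ω.2.1.1.2), (ω.2.1.1.1.2.2, ω.2.2.1)) := by fun_prop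
  unfold lawAUSdY
  rw [p.jointLaw_mix hα hβ Q W n]
  ext s hs
  simp only [Measure.map_apply hm hs, Measure.finsetSum_apply, Measure.smul_apply]

theorem iInf_infRate_le_mix {α β : Fin 2 → ℝ≥0} (hα : α 0 + α 1 = 1) (hβ : β 0 + β 1 = 1)
    (Q : Fin 2 → StateLaw 𝒜 𝒮e 𝒮 𝒮d) [∀ i n, IsMarkovKernel (Q i n)]
    (W : Fin 2 → Channel 𝒳 𝒮 𝒴 𝒵) [∀ j n, IsMarkovKernel (W j n)] :
    ⨅ i, ⨅ j, p.infRate (Q i) (W j) ≤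
      p.infRate (fun n => mix α fun i => Q i n) (fun n => mix β fun j => W j n) := by
  have hQ : ∀ n, IsMarkovKernel (mix α fun i => Q i n) := fun n => isMarkovKernel_mix hα _
  have hW : ∀ n, IsMarkovKernel (mix β fun j => W j n) := fun n => isMarkovKernel_mix hβ _
  rw [← iInf_prod (f := fun k : Fin 2 × Fin 2 => p.infRate (Q k.1) (W k.2))]
  exact iInf_infMutualInfoRate_le (fun k => ENNReal.mul_ne_top ENNReal.coe_ne_top ENNReal.coe_ne_top)
    _ (fun k : Fin 2 × Fin 2 => p.lawAUSdY (Q k.1) (W k.2)) (p.lawAUSdY_mix hα hβ Q W)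

theorem supRate_mix_le_iSup {α : Fin 2 → ℝ≥0} (hα : α 0 + α 1 = 1)
    (Q : Fin 2 → StateLaw 𝒜 𝒮e 𝒮 𝒮d) [∀ i n, IsMarkovKernel (Q i n)] :
    p.supRate (fun n => mix α fun i => Q i n) ≤ ⨆ i, p.supRate (Q i) := by
  have hQ : ∀ n, IsMarkovKernel (mix α fun i => Q i n) := fun n => isMarkovKernel_mix hα _
  refine supCondMutualInfoRate_le_iSup (w := fun i => (α i : ℝ≥0∞)) (fun i => ENNReal.coe_ne_top)
    p.lawA _ (fun i n => (Q i n).fst) p.lawU fun n a => ?_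
  ext s hs
  simp only [Measure.finsetSum_apply, Measure.smul_apply, Kernel.fst_apply' _ _ hs]
  change (∑ i, (α i : ℝ≥0∞) • Q i n a) _ = _
  simp

theorem avgDistortion_mix_le (d : ∀ n, Seq n 𝒮 × Seq n 𝒮hat → ℝ≥0)
    {α β : Fin 2 → ℝ≥0} (hα : α 0 + α 1 = 1) (hβ : β 0 + β 1 = 1)
    (Q : Fin 2 → StateLaw 𝒜 𝒮e 𝒮 𝒮d) [∀ i n, IsMarkovKernel (Q i n)]
    (W : Fin 2 → Channel 𝒳 𝒮 𝒴 𝒵) [∀ j n, IsMarkovKernel (W j n)] :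
    p.avgDistortion d (fun n => mix α fun i => Q i n) (fun n => mix β fun j => W j n) ≤
      ∑ i, ∑ j, (α i : ℝ≥0∞) * (β j : ℝ≥0∞) * p.avgDistortion d (Q i) (W j) := by
  rw [← Fintype.sum_prod_type'
    (f := fun i j => (α i : ℝ≥0∞) * (β j : ℝ≥0∞) * p.avgDistortion d (Q i) (W j))]
  unfold avgDistortion
  simp_rw [p.jointLaw_mix hα hβ Q W, lintegral_finsetSum_measure, lintegral_smul_measure,
    smul_eq_mul, div_eq_mul_inv, Finset.sum_mul]
  refine (limsup_finsetSum_le _ _).trans (Finset.sum_le_sum fun k _ => le_of_eq ?_)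
  simp_rw [mul_assoc ((α k.1 : ℝ≥0∞) * β k.2)]
  exact ENNReal.limsup_const_mul_of_ne_top
    (ENNReal.mul_ne_top ENNReal.coe_ne_top ENNReal.coe_ne_top)

end InputProcess

theorem distortionCapacity_mix_le (d : ∀ n, Seq n 𝒮 × Seq n 𝒮hat → ℝ≥0)
    {α β : Fin 2 → ℝ≥0} (hα : α 0 + α 1 = 1) (hβ : β 0 + β 1 = 1)
    (Q : Fin 2 → StateLaw 𝒜 𝒮e 𝒮 𝒮d) [∀ i n, IsMarkovKernel (Q i n)]
    (W : Fin 2 → Channel 𝒳 𝒮 𝒴 𝒵) [∀ j n, IsMarkovKernel (W j n)] (C : ℝ) :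
    distortionCapacity d (fun n => mix α fun i => Q i n) (fun n => mix β fun j => W j n) C ≤
      mixedDistortionBound d α β Q W C :=
  iSup₂_le fun p hp => le_iSup₂_of_le p
    -- Monotonicity of subtraction in `EReal` needs no side condition, so infinite rates require no
    -- separate case.
    ((EReal.sub_le_sub (p.iInf_infRate_le_mix hα hβ Q W) (p.supRate_mix_le_iSup hα Q)).trans hp)
    (p.avgDistortion_mix_le d hα hβ Q W)

end ISAC

/-! ### Codes and their worst messages -/

namespace ISAC

theorem eq_of_isProbabilityMeasure_of_subsingleton {α : Type u} [MeasurableSpace α] [Subsingleton α]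
    (μ ν : Measure α) [IsProbabilityMeasure μ] [IsProbabilityMeasure ν] : μ = ν := by
  ext s -
  rcases s.eq_empty_or_nonempty with rfl | hs
  · simp
  · simp [Subsingleton.eq_univ_of_nonempty hs]

theorem fst_prod_snd_of_eq_dirac_prod {α β : Type u} [MeasurableSpace α] [MeasurableSpace β] {a : α}
    {P : Measure (α × β)} {ν : Measure β} [IsProbabilityMeasure ν]
    (hP : P = (Measure.dirac a).prod ν) : P.fst.prod P.snd = P := by
  rw [hP, Measure.fst_prod, Measure.snd_prod]

variable {𝒜 𝒳 𝒮e 𝒮 𝒮d 𝒴 𝒵 𝒮hat : Type u}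
  [MeasurableSpace 𝒜] [MeasurableSpace 𝒳] [MeasurableSpace 𝒮e] [MeasurableSpace 𝒮]
  [MeasurableSpace 𝒮d] [MeasurableSpace 𝒴] [MeasurableSpace 𝒵] [MeasurableSpace 𝒮hat]

namespace Code

/-- The process obtained from codes by always sending the messages `m n`. -/
noncomputable def messageProcess (c : ∀ n, Code 𝒜 𝒳 𝒮e 𝒮d 𝒴 𝒵 𝒮hat n) (m : ∀ n, Fin (c n).M) :
    InputProcess 𝒜 𝒳 𝒮e 𝒵 𝒮hat where
  𝒰 := PUnit
  lawA n := Measure.dirac ((c n).fA (m n))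
  lawU _ := Kernel.const _ (Measure.dirac fun _ => PUnit.unit)
  lawX n := Kernel.deterministic (fun q => (c n).f (m n) q.2)
    (((c n).measurable_f (m n)).comp measurable_snd)
  g n := (c n).g
  measurable_g n := (c n).measurable_g

variable (c : ∀ n, Code 𝒜 𝒳 𝒮e 𝒮d 𝒴 𝒵 𝒮hat n) (m : ∀ n, Fin (c n).M)

instance (n : ℕ) : Subsingleton (Seq n (messageProcess c m).𝒰) :=
  inferInstanceAs (Subsingleton (Fin n → PUnit))

/-- Action and auxiliary sequence are deterministic, hence independent of the output. -/
theorem infRate_messageProcess_nonpos (Q : StateLaw 𝒜 𝒮e 𝒮 𝒮d) [∀ n, IsMarkovKernel (Q n)]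
    (W : Channel 𝒳 𝒮 𝒴 𝒵) [∀ n, IsMarkovKernel (W n)] :
    (messageProcess c m).infRate Q W ≤ 0 := by
  refine infMutualInfoRate_nonpos_of_indep _ fun n => ?_
  set p := messageProcess c m
  have hlaw : ∃ (x : Seq n 𝒜 × Seq n p.𝒰) (ν : Measure (Seq n 𝒮d × Seq n 𝒴)),
      IsProbabilityMeasure ν ∧ p.lawAUSdY Q W n = (Measure.dirac x).prod ν := by
    set a := (c n).fA (m n)
    obtain ⟨κ, hκ, hjoint⟩ : ∃ κ : Kernel (Seq n 𝒜)
        ((((Seq n 𝒮e × Seq n 𝒮 × Seq n 𝒮d) × Seq n p.𝒰) × Seq n 𝒳) × (Seq n 𝒴 × Seq n 𝒵)),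
        IsMarkovKernel κ ∧ p.jointLaw Q W n = Measure.dirac a ⊗ₘ κ :=
      ⟨_, inferInstance, rfl⟩
    have hV : Measurable fun ω : (((Seq n 𝒮e × Seq n 𝒮 × Seq n 𝒮d) × Seq n p.𝒰) × Seq n 𝒳) ×
        (Seq n 𝒴 × Seq n 𝒵) => (ω.1.1.1.2.2, ω.2.1) := by fun_prop
    refine ⟨(a, fun _ => PUnit.unit), (κ a).map fun ω => (ω.1.1.1.2.2, ω.2.1),
      Measure.isProbabilityMeasure_map hV.aemeasurable, ?_⟩
    rw [InputProcess.lawAUSdY, hjoint, dirac_compProd_eq_map, Measure.dirac_prod,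
      Measure.map_map (by fun_prop) measurable_prodMk_left, Measure.map_map measurable_prodMk_left hV]
    congr 1
  obtain ⟨x, ν, hν, h⟩ := hlaw
  exact fst_prod_snd_of_eq_dirac_prod h

theorem supRate_messageProcess_nonneg (Q : StateLaw 𝒜 𝒮e 𝒮 𝒮d) [∀ n, IsMarkovKernel (Q n)] :
    0 ≤ (messageProcess c m).supRate Q := by
  refine supCondMutualInfoRate_nonneg_of_condIndep _ _ fun n => ?_
  rw [InputProcess.condLawSeU, Kernel.fst_compProd, prod_eq_compProd_prodMkRight]
  -- The auxiliary sequence space has one point, so any two Markov kernels into it agree.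
  congr 1
  ext1 q
  exact eq_of_isProbabilityMeasure_of_subsingleton _ _

theorem rate_messageProcess_le (Q : Fin 2 → StateLaw 𝒜 𝒮e 𝒮 𝒮d) [∀ i n, IsMarkovKernel (Q i n)]
    (W : Fin 2 → Channel 𝒳 𝒮 𝒴 𝒵) [∀ j n, IsMarkovKernel (W j n)] :
    (⨅ i, ⨅ j, (messageProcess c m).infRate (Q i) (W j)) -
      (⨆ i, (messageProcess c m).supRate (Q i)) ≤ 0 := by
  rw [← sub_zero (0 : EReal)]
  exact EReal.sub_le_sub
    ((iInf₂_le 0 0).trans (infRate_messageProcess_nonpos c m (Q 0) (W 0)))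
    ((supRate_messageProcess_nonneg c m (Q 0)).trans (le_iSup (fun i => (messageProcess c m).supRate (Q i)) 0))

/-- Expected distortion of a code for a given message. -/
noncomputable def messageDistortion {n : ℕ} (c : Code 𝒜 𝒳 𝒮e 𝒮d 𝒴 𝒵 𝒮hat n)
    (d : ∀ n, Seq n 𝒮 × Seq n 𝒮hat → ℝ≥0) (Q : StateLaw 𝒜 𝒮e 𝒮 𝒮d)
    (W : Channel 𝒳 𝒮 𝒴 𝒵) (m : Fin c.M) : ℝ≥0∞ :=
  ∫⁻ s, ∫⁻ y, (d n (s.2.1, c.g (c.f m s.1, c.fA m, s.1, y.2)) : ℝ≥0∞)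
    ∂(W n (c.f m s.1, s.2.1)) ∂(Q n (c.fA m))

theorem exists_expectedDistortion_le {n : ℕ} (c : Code 𝒜 𝒳 𝒮e 𝒮d 𝒴 𝒵 𝒮hat n)
    (d : ∀ n, Seq n 𝒮 × Seq n 𝒮hat → ℝ≥0) (Q : StateLaw 𝒜 𝒮e 𝒮 𝒮d) (W : Channel 𝒳 𝒮 𝒴 𝒵) :
    ∃ m, c.expectedDistortion d Q W ≤ c.messageDistortion d Q W m := by
  obtain ⟨m, -, hm⟩ := Finset.exists_max_image Finset.univ (c.messageDistortion d Q W)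
    ⟨⟨0, c.M_pos⟩, Finset.mem_univ _⟩
  refine ⟨m, ENNReal.div_le_of_le_mul' ?_⟩
  have h := Finset.sum_le_card_nsmul _ _ _ hm
  rwa [Finset.card_univ, Fintype.card_fin, nsmul_eq_mul] at h

theorem avgDistortion_messageProcess {d : ∀ n, Seq n 𝒮 × Seq n 𝒮hat → ℝ≥0}
    (hd : ∀ n, Measurable (d n)) (Q : StateLaw 𝒜 𝒮e 𝒮 𝒮d) [∀ n, IsMarkovKernel (Q n)]
    (W : Channel 𝒳 𝒮 𝒴 𝒵) [∀ n, IsMarkovKernel (W n)] :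
    (messageProcess c m).avgDistortion d Q W =
      limsup (fun n => (c n).messageDistortion d Q W (m n) / n) atTop := by
  unfold InputProcess.avgDistortion
  congr 1
  funext n
  congr 1
  set p := messageProcess c m
  have hg : Measurable (p.g n) := p.measurable_g n
  have hf : Measurable fun ω : p.Outcome 𝒮 𝒮d 𝒴 n =>
      (d n (ω.2.1.1.1.2.1, p.g n (ω.2.1.2, ω.1, ω.2.1.1.1.1, ω.2.2.2)) : ℝ≥0∞) :=
    measurable_coe_nnreal_ennreal.comp ((hd n).comp
      (Measurable.prodMk (by fun_prop) (hg.comp (by fun_prop))))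
  rw [p.lintegral_jointLaw_of_lawA_eq_dirac Q W n (a := (c n).fA (m n)) rfl hf]
  refine lintegral_congr fun s => ?_
  refine (lintegral_dirac' _ Subsingleton.measurable).trans ?_
  refine Kernel.lintegral_deterministic' (g := fun q : Seq n p.𝒰 × Seq n 𝒮e => (c n).f (m n) q.2)
    (a := (fun _ => PUnit.unit, s.1)) (((c n).measurable_f (m n)).comp measurable_snd) ?_
  exact Measurable.lintegral_kernel_prod_right'
    (κ := (W n).comap (fun x : Seq n 𝒳 => (x, s.2.1)) (by fun_prop))
    (f := fun q : Seq n 𝒳 × (Seq n 𝒴 × Seq n 𝒵) =>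
      (d n (s.2.1, p.g n (q.1, (c n).fA (m n), s.1, q.2.2)) : ℝ≥0∞))
    (measurable_coe_nnreal_ennreal.comp ((hd n).comp
      (Measurable.prodMk (by fun_prop) (hg.comp (by fun_prop)))))

end Code

/-- The distortion of every sequence of codes on the mixed model obeys the bound at every
nonnegative rate: the worst messages of the codes form a process of rate at most zero. -/
theorem limsup_expectedDistortion_mix_le {d : ∀ n, Seq n 𝒮 × Seq n 𝒮hat → ℝ≥0}
    (hd : ∀ n, Measurable (d n)) {α β : Fin 2 → ℝ≥0} (hα : α 0 + α 1 = 1) (hβ : β 0 + β 1 = 1)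
    (Q : Fin 2 → StateLaw 𝒜 𝒮e 𝒮 𝒮d) [∀ i n, IsMarkovKernel (Q i n)]
    (W : Fin 2 → Channel 𝒳 𝒮 𝒴 𝒵) [∀ j n, IsMarkovKernel (W j n)] {C : ℝ} (hC : 0 ≤ C)
    (c : ∀ n, Code 𝒜 𝒳 𝒮e 𝒮d 𝒴 𝒵 𝒮hat n) :
    limsup (fun n => (c n).expectedDistortion d (fun n => mix α fun i => Q i n)
        (fun n => mix β fun j => W j n) / n) atTop ≤ mixedDistortionBound d α β Q W C := by
  have hQ : ∀ n, IsMarkovKernel (mix α fun i => Q i n) := fun n => isMarkovKernel_mix hα _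
  have hW : ∀ n, IsMarkovKernel (mix β fun j => W j n) := fun n => isMarkovKernel_mix hβ _
  -- The worst message is chosen for the mixed model; its distortion dominates the average over
  -- messages.
  choose m hm using fun n => (c n).exists_expectedDistortion_le d
    (fun n => mix α fun i => Q i n) (fun n => mix β fun j => W j n)
  calc _ ≤ (Code.messageProcess c m).avgDistortion d (fun n => mix α fun i => Q i n)
        (fun n => mix β fun j => W j n) := by
        rw [Code.avgDistortion_messageProcess c m hd]
        exact limsup_le_limsup (.of_forall fun n => ENNReal.div_le_div_right (hm n) _)
    _ ≤ _ := (Code.messageProcess c m).avgDistortion_mix_le d hα hβ Q W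
    _ ≤ _ := le_iSup₂_of_le (Code.messageProcess c m)
        ((Code.rate_messageProcess_le c m Q W).trans (by exact_mod_cast hC)) le_rfl

/-- Codes for any achievable `D` supply the rate and the error probability. Their distortion obeys
the bound automatically, so the bound itself is achievable. -/
theorem operationalDistortion_mix_le {d : ∀ n, Seq n 𝒮 × Seq n 𝒮hat → ℝ≥0}
    (hd : ∀ n, Measurable (d n)) {α β : Fin 2 → ℝ≥0} (hα : α 0 + α 1 = 1) (hβ : β 0 + β 1 = 1)
    (Q : Fin 2 → StateLaw 𝒜 𝒮e 𝒮 𝒮d) [∀ i n, IsMarkovKernel (Q i n)]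
    (W : Fin 2 → Channel 𝒳 𝒮 𝒴 𝒵) [∀ j n, IsMarkovKernel (W j n)] {C : ℝ} (hC : 0 ≤ C)
    {D : ℝ≥0} (hD : AverageAchievable d (fun n => mix α fun i => Q i n)
      (fun n => mix β fun j => W j n) C D) :
    operationalDistortion d (fun n => mix α fun i => Q i n) (fun n => mix β fun j => W j n) C ≤
      mixedDistortionBound d α β Q W C := by
  -- Achievable distortions are finite by definition, so the bound can serve as a witness only if
  -- finite.
  by_cases htop : mixedDistortionBound d α β Q W C = ∞
  · rw [htop]
    exact le_top
  lift mixedDistortionBound d α β Q W C to ℝ≥0 using htop with B hB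
  refine iInf₂_le B fun ε hε => ?_
  obtain ⟨c, hrate, herr, -⟩ := hD ε hε
  exact ⟨c, hrate, herr, hB ▸ limsup_expectedDistortion_mix_le hd hα hβ Q W hC c⟩

end ISAC

theorem theorem4 {𝒜 𝒳 𝒮e 𝒮 𝒮d 𝒴 𝒵 𝒮hat : Type u}
    [MeasurableSpace 𝒜] [MeasurableSpace 𝒳] [MeasurableSpace 𝒮e] [MeasurableSpace 𝒮]
    [MeasurableSpace 𝒮d] [MeasurableSpace 𝒴] [MeasurableSpace 𝒵] [MeasurableSpace 𝒮hat]
    (d : ∀ n, ISAC.Seq n 𝒮 × ISAC.Seq n 𝒮hat → ℝ≥0) (hd : ∀ n, Measurable (d n))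
    (α β : Fin 2 → ℝ≥0) (hα : α 0 + α 1 = 1) (hβ : β 0 + β 1 = 1)
    (Q : Fin 2 → ISAC.StateLaw 𝒜 𝒮e 𝒮 𝒮d) [∀ i n, IsMarkovKernel (Q i n)]
    (W : Fin 2 → ISAC.Channel 𝒳 𝒮 𝒴 𝒵) [∀ j n, IsMarkovKernel (W j n)]
    (C : ℝ) :
    -- the information-spectrum form of the distortion-capacity function, for every `C`
    ISAC.distortionCapacity d (fun n => ISAC.mix α fun i => Q i n)
        (fun n => ISAC.mix β fun j => W j n) C
      ≤ ISAC.mixedDistortionBound d α β Q W C ∧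
    -- its operational form, for every rate `C ≥ 0` at which some distortion is achievable
    (0 ≤ C →
      (∃ D : ℝ≥0, ISAC.AverageAchievable d (fun n => ISAC.mix α fun i => Q i n)
        (fun n => ISAC.mix β fun j => W j n) C D) →
      ISAC.operationalDistortion d (fun n => ISAC.mix α fun i => Q i n)
          (fun n => ISAC.mix β fun j => W j n) C
        ≤ ISAC.mixedDistortionBound d α β Q W C) :=
  ⟨ISAC.distortionCapacity_mix_le d hα hβ Q W C, fun hC ⟨_, hD⟩ =>
    ISAC.operationalDistortion_mix_le hd hα hβ Q W hC hD⟩
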